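/- **Setting.** Let $\mathcal B\subset\mathcal B(h)$ be a von Neumann algebra on a complex Hilbert space $h$. A *transition expectation* is a completely positive linear map $\mathcal E:\mathcal B\otimes\mathcal B\to\mathcal B$ (it suffices that it is defined on the algebraic tensor product) that is sub-Markovian: $\mathcal E(I\otimes I)\le I$. Let $(\mathcal E^{(n)})_{n\ge 0}$ be a sequence of transition expectations. For each $n$ the strong limit $$\bar b(n)=\lim_{k\to\infty}\mathcal E^{(n)}(I\otimes\mathcal E^{(n+1)}(I\otimes\cdots\otimes\mathcal E^{(n+k)}(I\otimes I)))\in\mathcal B$$ exists. Let $\mathcal A=\bigotimes_{i\ge 0}\mathcal B$ be the infinite tensor product of copies of $\mathcal B$, with embeddings $J_i:\mathcal B\to\mathcal A$, $J_i(b)=I\otimes\cdots\otimes I\otimes b\otimes I\otimes\cdots$ ($b$ at place $i$). Here it is taken as the von Neumann algebra generated by the algebraic infinite tensor product in its universal representation, namely the direct sum of the Stinespring dilations of all completely positive maps from the algebraic infinite tensor product to $\mathcal B$. The map $E_{0]}:\mathcal A\to\mathcal B$ is the normal completely positive map determined on elementary tensors $a=a_0\otimes a_1\otimes\cdots$ with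 $a_k=I$ for all large $k$ by the strong limit $$E_{0]}(a)=\lim_{n\to\infty}\mathcal E^{(0)}\bigl(a_0\otimes\mathcal E^{(1)}(a_1\otimes\cdots\otimes\mathcal E^{(n)}(a_n\otimes\bar b(n+1)))\bigr).$$ A *(nonhomogeneous) quantum Markov chain* is a pair $(\phi_0,(\mathcal E^{(n)})_{n\ge 0})$ of a state $\phi_0$ on $\mathcal B$ and a sequence of transition expectations such that $\phi_0(E_{0]}(I))=1$. For a projection $p\in\mathcal B$ and $n_0\ge 0$ put $$p_{[n_0}=I\otimes\cdots\otimes I\otimes p\otimes p\otimes\cdots\in\mathcal A$$ ($p$ at all places $k\ge n_0$), the infimum and strong limit of the projections $J_{n_0}(p)J_{n_0+1}(p)\cdots J_N(p)$ as $N\to\infty$; it is called nontrivial if $p\ne 0$ and $p\neq I$. The chain is *reducible* if there are a nontrivial projection $p\in\mathcal B$ and $n_0\ge 0$ such that $E_{0]}(p_{[n_0}\,a\,p_{[n_0})=E_{0]}(a)$ for all $a\in\mathcal A$. **Theorem.** A quantum Markov chain is reducible if and only if $E_{0]}(I-p_{[n_0})=0$ for some nontrivial projection $p_{[n_0}$,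 i.e. for some projection $p\in\mathcal B$ with $p\neq 0,I$ and some $n_0\ge 0$. -/

import Mathlib

open scoped InnerProductSpace TensorProduct ComplexOrder
open Filter Topology

universe u

namespace QuantumMarkov

noncomputable section

set_option linter.unusedSectionVars false

variable {H : Type u} [NormedAddCommGroup H] [InnerProductSpace ℂ H] [CompleteSpace H]

instance : SMulMemClass (VonNeumannAlgebra H) ℂ (H →L[ℂ] H) where
  smul_mem {s} c _ h := s.toStarSubalgebra.smul_mem h c

/-- The operator matrix `X`, acting on the direct sum of copies of `H`, is positive. -/
def IsPosMatrix {ι : Type*} [Fintype ι] (X : ι → ι → (H →L[ℂ] H)) : Prop :=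
  ∀ ξ : ι → H, 0 ≤ ∑ i, ∑ j, ⟪ξ i, X i j (ξ j)⟫_ℂ

lemma nonneg_iff_inner (x : H →L[ℂ] H) : 0 ≤ x ↔ ∀ ξ, 0 ≤ ⟪ξ, x ξ⟫_ℂ := by
  rw [ContinuousLinearMap.nonneg_iff_isPositive, ContinuousLinearMap.isPositive_iff_complex]
  constructor
  · intro h ξ
    obtain ⟨h1, h2⟩ := h ξ
    rw [← inner_conj_symm, ← h1]
    simpa using h2
  · intro h ξ
    have h0 := h ξ
    rw [← inner_conj_symm] at h0
    obtain ⟨hr, hi⟩ := Complex.le_def.1 h0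
    simp only [Complex.conj_re, Complex.conj_im, Complex.zero_re, Complex.zero_im] at hr hi
    refine ⟨?_, hr⟩
    apply Complex.ext <;> simp
    linarith

lemma exists_factor (x : H →L[ℂ] H) (hx : 0 ≤ x) :
    ∃ c : H →L[ℂ] H, star c * c = x ∧ ∀ y, Commute x y → Commute c y := by
  refine ⟨CFC.sqrt x, ?_, fun y hy => hy.cfcₙ_nnreal _⟩
  rw [(IsSelfAdjoint.of_nonneg (CFC.sqrt_nonneg x)).star_eq, CFC.sqrt_mul_sqrt_self x hx]

lemma mem_of_commute {B : VonNeumannAlgebra H} {c : H →L[ℂ] H}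
    (h : ∀ y ∈ B.commutant, Commute c y) : c ∈ B := by
  rw [← B.commutant_commutant, VonNeumannAlgebra.mem_commutant_iff]
  exact fun y hy => (h y hy).symm.eq

lemma commute_of_mem {B : VonNeumannAlgebra H} {c y : H →L[ℂ] H}
    (hc : c ∈ B) (hy : y ∈ B.commutant) : Commute c y :=
  VonNeumannAlgebra.mem_commutant_iff.1 hy c hc

lemma exists_factor_mem {B : VonNeumannAlgebra H} (x : H →L[ℂ] H) (hx : 0 ≤ x) (hB : x ∈ B) :
    ∃ c : B, star (c : H →L[ℂ] H) * c = x := by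
  obtain ⟨c, hc, hcomm⟩ := exists_factor x hx
  exact ⟨⟨c, mem_of_commute fun y hy => hcomm y (commute_of_mem hB hy)⟩, hc⟩

/-- A bounded operator dominates its absolute square inside any von Neumann algebra. -/
lemma exists_factor_bound {B : VonNeumannAlgebra H} (b : B) :
    ∃ c : B, star c * c = ((‖(b : H →L[ℂ] H)‖ ^ 2 : ℝ) : ℂ) • (1 : B) - star b * b := by
  have h0 : (0 : H →L[ℂ] H) ≤
      ((((‖(b : H →L[ℂ] H)‖ ^ 2 : ℝ) : ℂ) • (1 : B) - star b * b : B) : H →L[ℂ] H) := by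
    have := CStarAlgebra.star_mul_le_algebraMap_norm_sq (a := (b : H →L[ℂ] H))
    rw [← sub_nonneg] at this
    convert this using 1
    change (((‖(b : H →L[ℂ] H)‖ ^ 2 : ℝ) : ℂ) • (1 : H →L[ℂ] H)) - star (b : H →L[ℂ] H) * b = _
    rw [Algebra.algebraMap_eq_smul_one, Complex.coe_smul]
  obtain ⟨c, hc⟩ := exists_factor_mem _ h0 (Subtype.property _)
  exact ⟨c, Subtype.ext hc⟩

lemma inner_star_mul (c : H →L[ℂ] H) (ξ η : H) : ⟪ξ, (star c * c) η⟫_ℂ = ⟪c ξ, c η⟫_ℂ := by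
  rw [mul_apply_eq_comp, ContinuousLinearMap.star_eq_adjoint,
    ContinuousLinearMap.adjoint_inner_right]

section MatrixFactor
variable {n : ℕ}

/-- A positive matrix over a von Neumann algebra is a sum of elementary positive matrices. -/
lemma exists_matrix_factor {B : VonNeumannAlgebra H} (X : Fin n → Fin n → B)
    (hX : IsPosMatrix fun i j => (X i j : H →L[ℂ] H)) :
    ∃ Y : Fin n → Fin n → B, ∀ i j, X i j = ∑ r, star (Y r i) * Y r j := by
  classical
  let E := PiLp 2 (fun _ : Fin n => H)
  let pr (i : Fin n) : E →L[ℂ] H := PiLp.proj 2 (fun _ : Fin n => H) i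
  let inj (i : Fin n) : H →L[ℂ] E := ContinuousLinearMap.adjoint (pr i)
  have hpr : ∀ (v : E) i, pr i v = v.ofLp i := fun _ _ => rfl
  have hinner : ∀ v w : E, ⟪v, w⟫_ℂ = ∑ i, ⟪pr i v, pr i w⟫_ℂ := fun v w => PiLp.inner_apply v w
  have hinj : ∀ i j (ξ : H), pr i (inj j ξ) = if i = j then ξ else 0 := by
    intro i j ξ
    have : inj j ξ = WithLp.toLp 2 (Pi.single j ξ) := by
      apply ext_inner_left ℂ
      intro v
      simp only [inj, ContinuousLinearMap.adjoint_inner_right]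
      rw [hinner, Finset.sum_eq_single j]
      · rw [hpr (WithLp.toLp 2 (Pi.single j ξ))]
        simp
      · intro b _ hb
        rw [hpr (WithLp.toLp 2 (Pi.single j ξ))]
        simp [Pi.single_eq_of_ne hb]
      · simp
    rw [this, hpr (WithLp.toLp 2 (Pi.single j ξ))]
    by_cases h : i = j
    · subst h; simp
    · simp [h]
  have hsum : ∀ v : E, ∑ r, inj r (pr r v) = v := by
    intro v
    ext i
    have : (∑ r, inj r (pr r v)).ofLp i = pr i (∑ r, inj r (pr r v)) := rfl
    rw [this, map_sum]
    simp only [hinj, Finset.sum_ite_eq, Finset.mem_univ, if_true]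
    rfl
  let M : E →L[ℂ] E := ∑ i, ∑ j, inj i ∘L (X i j : H →L[ℂ] H) ∘L pr j
  have hMv : ∀ v i, pr i (M v) = ∑ j, (X i j : H →L[ℂ] H) (pr j v) := by
    intro v i
    simp only [M, sum_apply, map_sum, ContinuousLinearMap.comp_apply, hinj]
    rw [Finset.sum_eq_single i]
    · simp
    · intro b _ hb; simp [hb.symm]
    · simp
  have hM : 0 ≤ M := by
    rw [nonneg_iff_inner]
    intro v
    have := hX (fun i => pr i v)
    rw [hinner]
    convert this using 2 with i
    rw [← inner_sum]
    exact congrArg _ (hMv v i)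
  obtain ⟨c, hc, hcomm⟩ := exists_factor M hM
  have hmem : ∀ i j, pr i ∘L c ∘L inj j ∈ B := by
    intro i j
    apply mem_of_commute
    intro y hy
    let D : E →L[ℂ] E := ∑ i, inj i ∘L y ∘L pr i
    have hD : ∀ v i, pr i (D v) = y (pr i v) := by
      intro v i
      simp only [D, sum_apply, map_sum, ContinuousLinearMap.comp_apply, hinj]
      simp
    have hext : ∀ v w : E, (∀ i, pr i v = pr i w) → v = w := by
      intro v w h
      rw [← hsum v, ← hsum w]
      simp [h]
    have hMD : Commute M D := by
      apply ContinuousLinearMap.ext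
      intro v
      apply hext
      intro i
      simp only [mul_apply_eq_comp, hMv, hD, map_sum]
      refine Finset.sum_congr rfl fun j _ => ?_
      exact DFunLike.congr_fun (commute_of_mem (X i j).2 hy).eq (pr j v)
    have hcD := hcomm D hMD
    have hDinj : ∀ ξ, D (inj j ξ) = inj j (y ξ) := by
      intro ξ
      apply hext
      intro i
      rw [hD, hinj, hinj]
      split_ifs <;> simp
    apply ContinuousLinearMap.ext
    intro ξ
    simp only [mul_apply_eq_comp, ContinuousLinearMap.comp_apply]
    rw [← hDinj, ← hD]
    exact congrArg (pr i) (DFunLike.congr_fun hcD.eq (inj j ξ))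
  refine ⟨fun i j => ⟨pr i ∘L c ∘L inj j, hmem i j⟩, fun i j => ?_⟩
  apply Subtype.ext
  apply ContinuousLinearMap.ext
  intro ξ
  apply ext_inner_left ℂ
  intro η
  have h1 : (X i j : H →L[ℂ] H) ξ = pr i (M (inj j ξ)) := by
    rw [hMv, Finset.sum_eq_single j]
    · rw [hinj]; simp
    · intro b _ hb; simp [hinj, hb]
    · simp
  have h2 : ⟪η, pr i (M (inj j ξ))⟫_ℂ = ⟪c (inj i η), c (inj j ξ)⟫_ℂ := by
    rw [← hc, ← inner_star_mul]
    simp only [inj]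
    rw [← ContinuousLinearMap.adjoint_inner_left]
  have h3 : ((∑ r, star (⟨pr r ∘L c ∘L inj i, hmem r i⟩ : B) *
      (⟨pr r ∘L c ∘L inj j, hmem r j⟩ : B) : B) : H →L[ℂ] H) =
      ∑ r, star (pr r ∘L c ∘L inj i) * (pr r ∘L c ∘L inj j) := by
    rw [AddSubmonoidClass.coe_finsetSum]; rfl
  rw [h1, h2, h3, sum_apply, inner_sum, hinner]
  refine Finset.sum_congr rfl fun r _ => ?_
  rw [mul_apply_eq_comp, ContinuousLinearMap.star_eq_adjoint,
    ContinuousLinearMap.adjoint_inner_right]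
  rfl

end MatrixFactor

/-! ### Strong limits inside a von Neumann algebra -/

lemma exists_strong_limit {B : VonNeumannAlgebra H} (T : ℕ → B)
    (h : ∀ ξ, ∃ y, Tendsto (fun n => (T n : H →L[ℂ] H) ξ) atTop (𝓝 y)) :
    ∃ b : B, ∀ ξ, Tendsto (fun n => (T n : H →L[ℂ] H) ξ) atTop (𝓝 ((b : H →L[ℂ] H) ξ)) := by
  choose f hf using h
  let L : H →L[ℂ] H := continuousLinearMapOfTendsto (fun n => (T n : H →L[ℂ] H))
    (tendsto_pi_nhds.2 hf)
  have hL : ∀ ξ, L ξ = f ξ := fun ξ => rfl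
  refine ⟨⟨L, mem_of_commute fun y hy => ?_⟩, hf⟩
  apply ContinuousLinearMap.ext
  intro ξ
  refine tendsto_nhds_unique (hf (y ξ)) ?_
  have := (y.continuous.tendsto _).comp (hf ξ)
  refine this.congr fun n => ?_
  exact (DFunLike.congr_fun (commute_of_mem (T n).2 hy).eq ξ).symm

/-- The strong limit of a strongly convergent sequence in `B`. -/
def strongLim {B : VonNeumannAlgebra H} (T : ℕ → B)
    (h : ∀ ξ, ∃ y, Tendsto (fun n => (T n : H →L[ℂ] H) ξ) atTop (𝓝 y)) : B :=
  (exists_strong_limit T h).choose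

lemma strongLim_spec {B : VonNeumannAlgebra H} (T : ℕ → B)
    (h : ∀ ξ, ∃ y, Tendsto (fun n => (T n : H →L[ℂ] H) ξ) atTop (𝓝 y)) (ξ : H) :
    Tendsto (fun n => (T n : H →L[ℂ] H) ξ) atTop (𝓝 ((strongLim T h : H →L[ℂ] H) ξ)) :=
  (exists_strong_limit T h).choose_spec ξ

lemma exists_tendsto_of_antitone_bound (v : ℕ → H) (f : ℕ → ℝ) (N : ℕ) (hf : ∀ n, 0 ≤ f n)
    (h : ∀ n m, N ≤ n → n ≤ m → ‖v n - v m‖ ^ 2 ≤ f n - f m) :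
    ∃ y, Tendsto v atTop (𝓝 y) := by
  have hanti : Antitone fun n => f (n + N) := by
    intro n m hnm
    have := h (n + N) (m + N) (by omega) (by omega)
    have h0 : 0 ≤ ‖v (n + N) - v (m + N)‖ ^ 2 := by positivity
    simp only; linarith
  have hconv := tendsto_atTop_ciInf hanti ⟨0, by rintro _ ⟨n, rfl⟩; exact hf _⟩
  have hc := hconv.cauchySeq
  have : CauchySeq fun n => v (n + N) := by
    rw [Metric.cauchySeq_iff'] at hc ⊢
    intro ε hε
    obtain ⟨M, hM⟩ := hc (ε ^ 2) (by positivity)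
    refine ⟨M, fun n hn => ?_⟩
    have h1 := h (M + N) (n + N) (by omega) (by omega)
    have h2 := hM n hn
    rw [Real.dist_eq, abs_lt] at h2
    rw [dist_comm, dist_eq_norm]
    refine lt_of_pow_lt_pow_left₀ 2 hε.le ?_
    linarith [h2.1]
  obtain ⟨y, hy⟩ := cauchySeq_tendsto_of_complete this
  exact ⟨y, (tendsto_add_atTop_iff_nat N).1 hy⟩

/-! ### Transition expectations -/

/-- A transition expectation: a completely positive linear map `B ⊗ B → B` (a bilinear map on
`B × B`) with `ℰ (1 ⊗ 1) ≤ 1`. Complete positivity is the positivity of all operator matrices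
`[ℰ (xᵢ* xⱼ)]`. -/
structure TransitionExpectation (B : VonNeumannAlgebra H) where
  /-- the underlying linear map -/
  toLin : B ⊗[ℂ] B →ₗ[ℂ] B
  completelyPositive : ∀ (n : ℕ) (x : Fin n → B ⊗[ℂ] B),
    IsPosMatrix fun i j => (toLin (star (x i) * x j) : H →L[ℂ] H)
  subMarkovian : (toLin (1 ⊗ₜ 1) : H →L[ℂ] H) ≤ 1

variable {B : VonNeumannAlgebra H}

/-- `nested ℰ a m k b` is
`ℰ⁽ᵐ⁾(a_m ⊗ ℰ⁽ᵐ⁺¹⁾(a_{m+1} ⊗ ⋯ ⊗ ℰ⁽ᵐ⁺ᵏ⁻¹⁾(a_{m+k-1} ⊗ b)))`, with `k` applications. -/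
def nested (ℰ : ℕ → TransitionExpectation B) (a : ℕ → B) : ℕ → ℕ → B → B
  | _, 0, b => b
  | m, k + 1, b => (ℰ m).toLin (a m ⊗ₜ[ℂ] nested ℰ a (m + 1) k b)

lemma TransitionExpectation.pos_step (T : TransitionExpectation B) {n : ℕ} (a : Fin n → B)
    (X : Fin n → Fin n → B) (hX : IsPosMatrix fun i j => (X i j : H →L[ℂ] H)) :
    IsPosMatrix fun i j => (T.toLin ((star (a i) * a j) ⊗ₜ[ℂ] X i j) : H →L[ℂ] H) := by
  obtain ⟨Y, hY⟩ := exists_matrix_factor X hX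
  intro ξ
  have key : ∀ i j, (T.toLin ((star (a i) * a j) ⊗ₜ[ℂ] X i j) : H →L[ℂ] H) =
      ∑ r, (T.toLin (star (a i ⊗ₜ[ℂ] Y r i) * (a j ⊗ₜ[ℂ] Y r j)) : H →L[ℂ] H) := by
    intro i j
    rw [hY i j, TensorProduct.tmul_sum, map_sum, AddSubmonoidClass.coe_finsetSum]
    refine Finset.sum_congr rfl fun r _ => ?_
    rw [TensorProduct.star_tmul, Algebra.TensorProduct.tmul_mul_tmul]
  have : ∑ i, ∑ j, ⟪ξ i, (T.toLin ((star (a i) * a j) ⊗ₜ[ℂ] X i j) : H →L[ℂ] H) (ξ j)⟫_ℂ =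
      ∑ r, ∑ i, ∑ j, ⟪ξ i, (T.toLin (star (a i ⊗ₜ[ℂ] Y r i) * (a j ⊗ₜ[ℂ] Y r j)) :
        H →L[ℂ] H) (ξ j)⟫_ℂ := by
    simp only [key, sum_apply, inner_sum]
    rw [Finset.sum_comm]
    conv_lhs =>
      enter [2, j]
      rw [Finset.sum_comm]
    rw [Finset.sum_comm]
    exact Finset.sum_congr rfl fun r _ => Finset.sum_comm
  rw [this]
  exact Finset.sum_nonneg fun r _ => T.completelyPositive n (fun i => a i ⊗ₜ[ℂ] Y r i) ξ

variable (ℰ : ℕ → TransitionExpectation B)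

lemma nested_pos {n : ℕ} (s : Fin n → ℕ → B) (k m : ℕ) (b : B) (hb : 0 ≤ (b : H →L[ℂ] H)) :
    IsPosMatrix fun i j =>
      (nested ℰ (fun l => star (s i l) * s j l) m k b : H →L[ℂ] H) := by
  induction k generalizing m with
  | zero =>
    intro ξ
    have := (nonneg_iff_inner _).1 hb (∑ i, ξ i)
    rw [map_sum, sum_inner] at this
    simpa only [nested, inner_sum] using this
  | succ k ih => exact (ℰ m).pos_step (fun i => s i m) _ (ih (m + 1))

lemma nested_sub (a : ℕ → B) (k m : ℕ) (b c : B) :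
    nested ℰ a m k (b - c) = nested ℰ a m k b - nested ℰ a m k c := by
  induction k generalizing m with
  | zero => rfl
  | succ k ih => simp only [nested, ih, TensorProduct.tmul_sub, map_sub]

lemma nested_congr (a a' : ℕ → B) (k m : ℕ) (b : B)
    (h : ∀ l, m ≤ l → l < m + k → a l = a' l) : nested ℰ a m k b = nested ℰ a' m k b := by
  induction k generalizing m with
  | zero => rfl
  | succ k ih =>
    simp only [nested]
    rw [h m le_rfl (by omega), ih (m + 1) fun l h1 h2 => h l (by omega) (by omega)]

lemma nested_append (a : ℕ → B) (k l m : ℕ) (b : B) :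
    nested ℰ a m (k + l) b = nested ℰ a m k (nested ℰ a (m + k) l b) := by
  induction k generalizing m with
  | zero => simp [nested]
  | succ k ih =>
    have h1 : k + 1 + l = (k + l) + 1 := by omega
    have h2 : m + (k + 1) = m + 1 + k := by omega
    rw [h1, h2]
    simp only [nested]
    rw [ih]

lemma nested_add (s t u : ℕ → B) (i k m : ℕ) (b : B) (h1 : m ≤ i) (h2 : i < m + k)
    (h : ∀ l, l ≠ i → t l = s l ∧ u l = s l) (hi : u i = s i + t i) :
    nested ℰ u m k b = nested ℰ s m k b + nested ℰ t m k b := by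
  induction k generalizing m with
  | zero => omega
  | succ k ih =>
    simp only [nested]
    by_cases him : i = m
    · subst him
      rw [nested_congr ℰ u s k (i + 1) b fun l hl _ => (h l (by omega)).2,
        nested_congr ℰ t s k (i + 1) b fun l hl _ => (h l (by omega)).1, hi,
        TensorProduct.add_tmul, map_add]
    · rw [ih (m + 1) (by omega) (by omega), (h m (Ne.symm him)).1, (h m (Ne.symm him)).2,
        TensorProduct.tmul_add, map_add]

lemma nested_smul (s t : ℕ → B) (c : ℂ) (i k m : ℕ) (b : B) (h1 : m ≤ i) (h2 : i < m + k)
    (h : ∀ l, l ≠ i → t l = s l) (hi : t i = c • s i) :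
    nested ℰ t m k b = c • nested ℰ s m k b := by
  induction k generalizing m with
  | zero => omega
  | succ k ih =>
    simp only [nested]
    by_cases him : i = m
    · subst him
      rw [nested_congr ℰ t s k (i + 1) b fun l hl _ => h l (by omega), hi,
        ← TensorProduct.smul_tmul', map_smul]
    · rw [ih (m + 1) (by omega) (by omega), h m (Ne.symm him), TensorProduct.tmul_smul, map_smul]

lemma nested_one_nonneg (k m : ℕ) (b : B) (hb : 0 ≤ (b : H →L[ℂ] H)) :
    0 ≤ (nested ℰ 1 m k b : H →L[ℂ] H) := by
  rw [nonneg_iff_inner]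
  intro ξ
  have := nested_pos ℰ (fun (_ : Fin 1) (_ : ℕ) => (1 : B)) k m b hb (fun _ => ξ)
  simp only [star_one, mul_one, Finset.univ_unique, Finset.sum_const, Finset.card_singleton,
    one_smul] at this
  exact this

lemma nested_one_mono (k m : ℕ) (b c : B) (h : (b : H →L[ℂ] H) ≤ c) :
    (nested ℰ 1 m k b : H →L[ℂ] H) ≤ nested ℰ 1 m k c := by
  have := nested_one_nonneg ℰ k m (c - b) (by simpa using h)
  rw [nested_sub] at this
  simpa using this

lemma nested_one_le (k m : ℕ) : (nested ℰ 1 m k 1 : H →L[ℂ] H) ≤ 1 := by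
  induction k generalizing m with
  | zero => exact le_rfl
  | succ k ih =>
    refine le_trans (nested_one_mono ℰ 1 m (nested ℰ 1 (m + 1) k 1) 1 (ih (m + 1))) ?_
    exact (ℰ m).subMarkovian

lemma IsPosMatrix.hermitian_two {X : Fin 2 → Fin 2 → (H →L[ℂ] H)} (hX : IsPosMatrix X)
    (ξ η : H) : ⟪ξ, X 0 1 η⟫_ℂ = (starRingEnd ℂ) ⟪η, X 1 0 ξ⟫_ℂ := by
  have h1 := hX ![ξ, 0]
  have h2 := hX ![0, η]
  have h3 := hX ![ξ, η]
  have h4 := hX ![ξ, Complex.I • η]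
  simp only [Fin.sum_univ_two, Matrix.cons_val_zero, Matrix.cons_val_one, map_zero,
    inner_zero_left, inner_zero_right, add_zero, zero_add, map_smul, inner_smul_left,
    inner_smul_right, Complex.conj_I] at h1 h2 h3 h4
  rw [Complex.le_def] at h1 h2 h3 h4
  apply Complex.ext
  · have := h4.2
    simp only [Complex.add_im, Complex.mul_im, Complex.mul_re, Complex.neg_re, Complex.neg_im,
      Complex.I_re, Complex.I_im, Complex.zero_im, Complex.conj_re] at this h1 h2 ⊢
    linarith [h1.2, h2.2]
  · have := h3.2
    simp only [Complex.add_im, Complex.zero_im, Complex.conj_im] at this h1 h2 ⊢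
    linarith [h1.2, h2.2]

lemma IsPosMatrix.norm_sq_le {X : Fin 2 → Fin 2 → (H →L[ℂ] H)} (hX : IsPosMatrix X)
    (h1 : X 0 0 ≤ 1) (ξ : H) : ‖X 0 1 ξ‖ ^ 2 ≤ (⟪ξ, X 1 1 ξ⟫_ℂ).re := by
  set v := X 0 1 ξ with hv
  have h3 := (Complex.le_def.1 (hX ![-v, ξ])).1
  have h4 := hX.hermitian_two v ξ
  rw [← hv] at h4
  have h5 := (Complex.le_def.1 ((nonneg_iff_inner _).1 (sub_nonneg.2 h1) v)).1
  have h6 : (⟪v, v⟫_ℂ).re = ‖v‖ ^ 2 := by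
    have := inner_self_eq_norm_sq (𝕜 := ℂ) v
    simpa using this
  have h7 : (⟪ξ, X 1 0 v⟫_ℂ).re = ‖v‖ ^ 2 := by
    rw [← h6, h4, Complex.conj_re]
  simp only [Fin.sum_univ_two, Matrix.cons_val_zero, Matrix.cons_val_one, map_neg,
    inner_neg_left, inner_neg_right, neg_neg, ← hv, Complex.add_re, Complex.neg_re,
    Complex.zero_re, sub_apply, one_apply_eq_self, inner_sub_right, Complex.sub_re, h6, h7] at h3 h5
  linarith

lemma tendsto_nested_one (n : ℕ) (ξ : H) : ∃ y,
    Tendsto (fun k => (nested ℰ 1 n (k + 1) 1 : H →L[ℂ] H) ξ) atTop (𝓝 y) := by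
  refine exists_tendsto_of_antitone_bound _
    (fun k => (⟪ξ, (nested ℰ 1 n (k + 1) 1 : H →L[ℂ] H) ξ⟫_ℂ).re) 0
    (fun k => (Complex.le_def.1 ((nonneg_iff_inner _).1
      (nested_one_nonneg ℰ (k + 1) n 1 zero_le_one) ξ)).1) ?_
  intro k l _ hkl
  obtain ⟨d, rfl⟩ := Nat.exists_eq_add_of_le hkl
  have hd : k + d + 1 = (k + 1) + d := by omega
  set c : B := 1 - nested ℰ 1 (n + (k + 1)) d 1 with hc
  have hc0 : 0 ≤ (c : H →L[ℂ] H) := by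
    simpa [hc] using nested_one_le ℰ d (n + (k + 1))
  have hD : (nested ℰ 1 n (k + 1) 1 : B) - nested ℰ 1 n (k + d + 1) 1 =
      nested ℰ 1 n (k + 1) c := by
    rw [hd, nested_append ℰ 1 (k + 1) d, hc, nested_sub]
  have hD1 : (nested ℰ 1 n (k + 1) c : H →L[ℂ] H) ≤ 1 := by
    refine le_trans (nested_one_mono ℰ _ _ c 1 ?_) (nested_one_le ℰ (k + 1) n)
    simpa [hc] using nested_one_nonneg ℰ d (n + (k + 1)) 1 zero_le_one
  have hp : IsPosMatrix fun (_ _ : Fin 2) => (nested ℰ 1 n (k + 1) c : H →L[ℂ] H) := by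
    have := nested_pos ℰ (fun (_ : Fin 2) (_ : ℕ) => (1 : B)) (k + 1) n c hc0
    simp only [star_one, mul_one] at this
    exact this
  have := hp.norm_sq_le hD1 ξ
  rw [← hD] at this
  simpa [inner_sub_right] using this

/-- The strong limit `b̄(n) = lim_k ℰ⁽ⁿ⁾(1 ⊗ ℰ⁽ⁿ⁺¹⁾(1 ⊗ ⋯ ⊗ ℰ⁽ⁿ⁺ᵏ⁾(1 ⊗ 1)))`. -/
def bbar (n : ℕ) : B :=
  strongLim (fun k => nested ℰ 1 n (k + 1) 1) (tendsto_nested_one ℰ n)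

lemma bbar_spec (n : ℕ) (ξ : H) :
    Tendsto (fun k => (nested ℰ 1 n (k + 1) 1 : H →L[ℂ] H) ξ) atTop
      (𝓝 ((bbar ℰ n : H →L[ℂ] H) ξ)) :=
  strongLim_spec _ _ ξ

lemma bbar_ge (n : ℕ) (x : H →L[ℂ] H)
    (h : ∀ᶠ k in atTop, x ≤ (nested ℰ 1 n (k + 1) 1 : H →L[ℂ] H)) :
    x ≤ (bbar ℰ n : H →L[ℂ] H) := by
  rw [← sub_nonneg, nonneg_iff_inner]
  intro ξ
  have h1 : Tendsto (fun k => ⟪ξ, ((nested ℰ 1 n (k + 1) 1 : H →L[ℂ] H) - x) ξ⟫_ℂ) atTop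
      (𝓝 ⟪ξ, ((bbar ℰ n : H →L[ℂ] H) - x) ξ⟫_ℂ) := by
    simp only [sub_apply]
    exact tendsto_const_nhds.inner ((bbar_spec ℰ n ξ).sub tendsto_const_nhds)
  refine ge_of_tendsto h1 (h.mono fun k hk => ?_)
  exact (nonneg_iff_inner _).1 (sub_nonneg.2 hk) ξ

lemma bbar_le_of (n : ℕ) (x : H →L[ℂ] H)
    (h : ∀ᶠ k in atTop, (nested ℰ 1 n (k + 1) 1 : H →L[ℂ] H) ≤ x) :
    (bbar ℰ n : H →L[ℂ] H) ≤ x := by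
  rw [← sub_nonneg, nonneg_iff_inner]
  intro ξ
  have h1 : Tendsto (fun k => ⟪ξ, (x - (nested ℰ 1 n (k + 1) 1 : H →L[ℂ] H)) ξ⟫_ℂ) atTop
      (𝓝 ⟪ξ, (x - (bbar ℰ n : H →L[ℂ] H)) ξ⟫_ℂ) := by
    simp only [sub_apply]
    exact tendsto_const_nhds.inner (tendsto_const_nhds.sub (bbar_spec ℰ n ξ))
  refine ge_of_tendsto h1 (h.mono fun k hk => ?_)
  exact (nonneg_iff_inner _).1 (sub_nonneg.2 hk) ξ

lemma bbar_nonneg (n : ℕ) : 0 ≤ (bbar ℰ n : H →L[ℂ] H) :=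
  bbar_ge ℰ n 0 (Eventually.of_forall fun k => nested_one_nonneg ℰ (k + 1) n 1 zero_le_one)

lemma bbar_le_one (n : ℕ) : (bbar ℰ n : H →L[ℂ] H) ≤ 1 :=
  bbar_le_of ℰ n 1 (Eventually.of_forall fun k => nested_one_le ℰ (k + 1) n)

lemma nested_one_anti (n k l : ℕ) (h : k ≤ l) :
    (nested ℰ 1 n l 1 : H →L[ℂ] H) ≤ nested ℰ 1 n k 1 := by
  obtain ⟨d, rfl⟩ := Nat.exists_eq_add_of_le h
  rw [nested_append]
  exact nested_one_mono ℰ _ _ _ _ (nested_one_le ℰ _ _)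

lemma nested_bbar_le (n d : ℕ) :
    (nested ℰ 1 n d (bbar ℰ (n + d)) : H →L[ℂ] H) ≤ bbar ℰ n := by
  refine bbar_ge ℰ n _ ?_
  filter_upwards [eventually_ge_atTop d] with k hk
  obtain ⟨e, he⟩ := Nat.exists_eq_add_of_le hk
  have h1 : k + 1 = d + (e + 1) := by omega
  rw [h1, nested_append]
  refine nested_one_mono ℰ _ _ _ _ (bbar_le_of ℰ _ _ ?_)
  filter_upwards [eventually_ge_atTop e] with j hj
  exact nested_one_anti ℰ _ _ _ (by omega)

/-! ### The algebraic infinite tensor product and its completely positive maps -/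

variable (B) in
/-- The elementary tensors `a₀ ⊗ a₁ ⊗ ⋯ ⊗ aₙ ⊗ 1 ⊗ 1 ⊗ ⋯`, as sequences that are eventually `1`.
They form a `*`-monoid that spans the algebraic infinite tensor product of copies of `B`. -/
def LocalTensor : Submonoid (ℕ → B) where
  carrier := {a | ∃ n, ∀ k, n ≤ k → a k = 1}
  one_mem' := ⟨0, fun _ _ => rfl⟩
  mul_mem' := by
    rintro a b ⟨n, hn⟩ ⟨m, hm⟩
    refine ⟨max n m, fun k hk => ?_⟩
    simp [hn k (le_trans (le_max_left _ _) hk), hm k (le_trans (le_max_right _ _) hk)]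

instance : StarMul (LocalTensor B) where
  star a := ⟨fun k => star (a.1 k), by
    obtain ⟨n, hn⟩ := a.2
    exact ⟨n, fun k hk => by simp [hn k hk]⟩⟩
  star_involutive a := Subtype.ext (funext fun k => star_star _)
  star_mul a b := Subtype.ext (funext fun k => star_mul _ _)

lemma LocalTensor.star_apply (s : LocalTensor B) (k : ℕ) : (star s).1 k = star (s.1 k) := rfl

lemma LocalTensor.mul_apply (s t : LocalTensor B) (k : ℕ) : (s * t).1 k = s.1 k * t.1 k := rfl

variable (B) in
/-- A completely positive linear map from the algebraic infinite tensor product of copies of `B`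
to `B`, given as a map on elementary tensors that is linear in every tensor factor. -/
structure LocalCPMap where
  /-- the values on elementary tensors -/
  toFun : LocalTensor B → B
  map_add : ∀ (i : ℕ) (s t u : LocalTensor B), (∀ k, k ≠ i → t.1 k = s.1 k ∧ u.1 k = s.1 k) →
    u.1 i = s.1 i + t.1 i → toFun u = toFun s + toFun t
  map_smul : ∀ (i : ℕ) (c : ℂ) (s t : LocalTensor B), (∀ k, k ≠ i → t.1 k = s.1 k) →
    t.1 i = c • s.1 i → toFun t = c • toFun s
  completelyPositive : ∀ (n : ℕ) (s : Fin n → LocalTensor B),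
    IsPosMatrix fun i j => (toFun (star (s i) * s j) : H →L[ℂ] H)

lemma tendsto_nested (s : LocalTensor B) (ξ : H) : ∃ y,
    Tendsto (fun n => (nested ℰ s.1 0 (n + 1) (bbar ℰ (n + 1)) : H →L[ℂ] H) ξ) atTop (𝓝 y) := by
  obtain ⟨N, hN⟩ := s.2
  refine exists_tendsto_of_antitone_bound _
    (fun n => (⟪ξ, (nested ℰ (star s * s).1 0 (n + 1) (bbar ℰ (n + 1)) : H →L[ℂ] H) ξ⟫_ℂ).re) N
    ?_ ?_
  · intro n
    have := nested_pos ℰ (fun _ : Fin 1 => s.1) (n + 1) 0 _ (bbar_nonneg ℰ (n + 1)) (fun _ => ξ)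
    simp only [Finset.univ_unique, Finset.sum_const, Finset.card_singleton, one_smul] at this
    exact (Complex.le_def.1 this).1
  · intro n m hn hnm
    obtain ⟨d, rfl⟩ := Nat.exists_eq_add_of_le hnm
    have hd : n + d + 1 = (n + 1) + d := by omega
    set c : B := bbar ℰ (n + 1) - nested ℰ 1 (n + 1) d (bbar ℰ (n + 1 + d)) with hc
    have hc0 : 0 ≤ (c : H →L[ℂ] H) := by
      simpa [hc] using nested_bbar_le ℰ (n + 1) d
    have hc1 : (c : H →L[ℂ] H) ≤ 1 := by
      refine le_trans ?_ (bbar_le_one ℰ (n + 1))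
      simpa [hc] using nested_one_nonneg ℰ d (n + 1) _ (bbar_nonneg ℰ (n + 1 + d))
    have hD : ∀ t : ℕ → B, (∀ k, N ≤ k → t k = 1) →
        nested ℰ t 0 (n + 1) (bbar ℰ (n + 1)) - nested ℰ t 0 (n + d + 1) (bbar ℰ (n + d + 1)) =
        nested ℰ t 0 (n + 1) c := by
      intro t ht
      rw [hd, nested_append ℰ t (n + 1) d, hc, nested_sub, zero_add,
        nested_congr ℰ t 1 d (n + 1) _ fun l h1 _ => ht l (by omega)]
    have hp := nested_pos ℰ ![1, s.1] (n + 1) 0 c hc0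
    have h00 : (nested ℰ (fun l => star (![1, s.1] 0 l) * ![1, s.1] 0 l) 0 (n + 1) c :
        H →L[ℂ] H) ≤ 1 := by
      have : (fun l => star ((![1, s.1] : Fin 2 → ℕ → B) 0 l) * (![1, s.1] : Fin 2 → ℕ → B) 0 l) =
          (1 : ℕ → B) := by
        funext l; simp
      rw [this]
      exact le_trans (nested_one_mono ℰ _ _ c 1 hc1) (nested_one_le ℰ (n + 1) 0)
    have key := hp.norm_sq_le h00 ξ
    have h01 : (fun l => star ((![1, s.1] : Fin 2 → ℕ → B) 0 l) *
        (![1, s.1] : Fin 2 → ℕ → B) 1 l) = s.1 := by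
      funext l; simp
    have h11 : (fun l => star ((![1, s.1] : Fin 2 → ℕ → B) 1 l) *
        (![1, s.1] : Fin 2 → ℕ → B) 1 l) = (star s * s).1 := by
      funext l; simp [LocalTensor.mul_apply, LocalTensor.star_apply]
    rw [h01, h11, ← hD s.1 hN, ← hD (star s * s).1 fun k hk => by
      simp [LocalTensor.mul_apply, LocalTensor.star_apply, hN k hk]] at key
    simpa [inner_sub_right] using key

/-- The map `E_{0]}` on elementary tensors:
`E_{0]}(a₀ ⊗ a₁ ⊗ ⋯) = lim_n ℰ⁽⁰⁾(a₀ ⊗ ℰ⁽¹⁾(a₁ ⊗ ⋯ ⊗ ℰ⁽ⁿ⁾(aₙ ⊗ b̄(n+1))))`, a strong limit. -/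
def localE0 : LocalCPMap B where
  toFun s := strongLim (fun n => nested ℰ s.1 0 (n + 1) (bbar ℰ (n + 1))) (tendsto_nested ℰ s)
  map_add i s t u h hi := by
    apply Subtype.ext
    apply ContinuousLinearMap.ext
    intro ξ
    refine tendsto_nhds_unique (strongLim_spec _ (tendsto_nested ℰ u) ξ) ?_
    refine Tendsto.congr' ?_ ((strongLim_spec _ (tendsto_nested ℰ s) ξ).add
      (strongLim_spec _ (tendsto_nested ℰ t) ξ))
    filter_upwards [eventually_ge_atTop i] with n hn
    rw [nested_add ℰ s.1 t.1 u.1 i (n + 1) 0 _ (by omega) (by omega) h hi]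
    rfl
  map_smul i c s t h hi := by
    apply Subtype.ext
    apply ContinuousLinearMap.ext
    intro ξ
    refine tendsto_nhds_unique (strongLim_spec _ (tendsto_nested ℰ t) ξ) ?_
    refine Tendsto.congr' ?_ ((strongLim_spec _ (tendsto_nested ℰ s) ξ).const_smul c)
    filter_upwards [eventually_ge_atTop i] with n hn
    rw [nested_smul ℰ s.1 t.1 c i (n + 1) 0 _ (by omega) (by omega) h hi]
    rfl
  completelyPositive n s := by
    intro ξ
    have h : Tendsto (fun m => ∑ i, ∑ j, ⟪ξ i, (nested ℰ (star (s i) * s j).1 0 (m + 1)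
        (bbar ℰ (m + 1)) : H →L[ℂ] H) (ξ j)⟫_ℂ) atTop (𝓝 (∑ i, ∑ j, ⟪ξ i, (strongLim
          (fun n => nested ℰ (star (s i) * s j).1 0 (n + 1) (bbar ℰ (n + 1)))
          (tendsto_nested ℰ (star (s i) * s j)) : H →L[ℂ] H) (ξ j)⟫_ℂ)) :=
      tendsto_finsetSum _ fun i _ => tendsto_finsetSum _ fun j _ =>
        tendsto_const_nhds.inner (strongLim_spec _ (tendsto_nested ℰ (star (s i) * s j)) (ξ j))
    exact ge_of_tendsto h <| Eventually.of_forall fun m =>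
      nested_pos ℰ (fun i => (s i).1) (m + 1) 0 _ (bbar_nonneg ℰ (m + 1)) ξ

lemma localE0_spec (s : LocalTensor B) (ξ : H) :
    Tendsto (fun n => (nested ℰ s.1 0 (n + 1) (bbar ℰ (n + 1)) : H →L[ℂ] H) ξ) atTop
      (𝓝 (((localE0 ℰ).toFun s : H →L[ℂ] H) ξ)) :=
  strongLim_spec _ (tendsto_nested ℰ s) ξ

/-! ### The dilation of a completely positive map -/

/-- The elementary tensor `J_i(b) = 1 ⊗ ⋯ ⊗ 1 ⊗ b ⊗ 1 ⊗ ⋯` with `b` at the `i`-th place. -/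
def LocalTensor.single (i : ℕ) (b : B) : LocalTensor B :=
  ⟨fun k => if k = i then b else 1, i + 1, fun k hk => if_neg (by omega)⟩

lemma LocalTensor.single_same (i : ℕ) (b : B) : (LocalTensor.single i b).1 i = b :=
  if_pos rfl

lemma LocalTensor.single_ne (i k : ℕ) (h : k ≠ i) (b : B) : (LocalTensor.single i b).1 k = 1 :=
  if_neg h

lemma LocalTensor.star_single (i : ℕ) (b : B) :
    star (LocalTensor.single i b) = LocalTensor.single i (star b) := by
  apply Subtype.ext
  funext k
  rw [star_apply]
  by_cases h : k = i
  · subst h; simp [single_same]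
  · simp [single_ne _ _ h]

lemma LocalTensor.single_mul (i : ℕ) (b c : B) :
    LocalTensor.single i b * LocalTensor.single i c = LocalTensor.single i (b * c) := by
  apply Subtype.ext
  funext k
  rw [mul_apply]
  by_cases h : k = i
  · subst h; simp [single_same]
  · simp [single_ne _ _ h]

namespace LocalCPMap

variable (F : LocalCPMap B)

lemma hermitian (s t : LocalTensor B) (ξ η : H) :
    ⟪ξ, (F.toFun (star s * t) : H →L[ℂ] H) η⟫_ℂ =
      (starRingEnd ℂ) ⟪η, (F.toFun (star t * s) : H →L[ℂ] H) ξ⟫_ℂ :=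
  (F.completelyPositive 2 ![s, t]).hermitian_two ξ η

/-- Finite sums `∑ s ⊗ ξ` of elementary tensors and vectors. -/
def PreSpace (_F : LocalCPMap B) : Type u := LocalTensor B →₀ H

instance : AddCommGroup F.PreSpace := inferInstanceAs (AddCommGroup (LocalTensor B →₀ H))
instance : Module ℂ F.PreSpace := inferInstanceAs (Module ℂ (LocalTensor B →₀ H))

/-- The semi-inner product `⟪s ⊗ ξ, t ⊗ η⟫ = ⟪ξ, F (s* t) η⟫`. -/
def form (f g : LocalTensor B →₀ H) : ℂ :=
  f.sum fun s ξ => g.sum fun t η => ⟪ξ, (F.toFun (star s * t) : H →L[ℂ] H) η⟫_ℂ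

lemma form_conj (f g : LocalTensor B →₀ H) : (starRingEnd ℂ) (F.form g f) = F.form f g := by
  simp only [form, Finsupp.sum, map_sum]
  rw [Finset.sum_comm]
  exact Finset.sum_congr rfl fun s _ => Finset.sum_congr rfl fun t _ => (F.hermitian s t _ _).symm

lemma form_nonneg (f : LocalTensor B →₀ H) : 0 ≤ F.form f f := by
  have e := f.support.equivFin.symm
  have h := F.completelyPositive f.support.card (fun i => (e i).1) (fun i => f (e i).1)
  have h1 : F.form f f = ∑ i, ∑ j, ⟪f (e i).1,
      (F.toFun (star (e i).1 * (e j).1) : H →L[ℂ] H) (f (e j).1)⟫_ℂ := by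
    simp only [form, Finsupp.sum]
    rw [← Finset.sum_coe_sort, ← e.sum_comp]
    refine Finset.sum_congr rfl fun i _ => ?_
    rw [← Finset.sum_coe_sort, ← e.sum_comp]
  rw [h1]
  exact h

lemma form_add_left (f g h : LocalTensor B →₀ H) : F.form (f + g) h = F.form f h + F.form g h := by
  refine Finsupp.sum_add_index' (fun s => ?_) (fun s ξ η => ?_)
  · simp
  · simp [Finsupp.sum, Finset.sum_add_distrib]

lemma form_smul_left (c : ℂ) (f h : LocalTensor B →₀ H) :
    F.form (c • f) h = (starRingEnd ℂ) c * F.form f h := by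
  unfold form
  rw [Finsupp.sum_smul_index' (fun s => by simp)]
  simp only [inner_smul_left, Finsupp.sum, Finset.mul_sum]

/-- The semi-inner product on `PreSpace`. -/
abbrev core : PreInnerProductSpace.Core ℂ F.PreSpace where
  inner f g := F.form f g
  conj_inner_symm f g := F.form_conj f g
  re_inner_nonneg f := (Complex.le_def.1 (F.form_nonneg f)).1
  add_left f g h := F.form_add_left f g h
  smul_left f g c := F.form_smul_left c f g

instance : SeminormedAddCommGroup F.PreSpace :=
  InnerProductSpace.Core.toSeminormedAddCommGroup (c := F.core)
instance : InnerProductSpace ℂ F.PreSpace := InnerProductSpace.ofCore F.core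

/-- The class of a finite sum `∑ s ⊗ ξ`. -/
def toPre : (LocalTensor B →₀ H) ≃ₗ[ℂ] F.PreSpace := LinearEquiv.refl ℂ _

lemma inner_toPre (f g : LocalTensor B →₀ H) : ⟪F.toPre f, F.toPre g⟫_ℂ = F.form f g := rfl

lemma norm_sq (f : LocalTensor B →₀ H) : ‖F.toPre f‖ ^ 2 = (F.form f f).re :=
  norm_sq_eq_re_inner (𝕜 := ℂ) (F.toPre f)

/-- Left multiplication `t ⊗ ξ ↦ (u t) ⊗ ξ`. -/
def shift (u : LocalTensor B) : (LocalTensor B →₀ H) →ₗ[ℂ] (LocalTensor B →₀ H) :=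
  Finsupp.lmapDomain H ℂ (fun t => u * t)

/-- Amplification `t ⊗ ξ ↦ t ⊗ (T ξ)`. -/
def amp (T : H →L[ℂ] H) : (LocalTensor B →₀ H) →ₗ[ℂ] (LocalTensor B →₀ H) :=
  Finsupp.mapRange.linearMap T.toLinearMap

lemma form_shift_left (u : LocalTensor B) (f g : LocalTensor B →₀ H) :
    F.form (shift u f) g = f.sum fun s ξ => g.sum fun t η =>
      ⟪ξ, (F.toFun (star s * (star u * t)) : H →L[ℂ] H) η⟫_ℂ := by
  unfold form shift
  rw [Finsupp.lmapDomain_apply, Finsupp.sum_mapDomain_index (fun s => by simp)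
    (fun s ξ η => by simp [Finsupp.sum, Finset.sum_add_distrib])]
  simp only [star_mul, mul_assoc]

lemma form_shift_right (u : LocalTensor B) (f g : LocalTensor B →₀ H) :
    F.form f (shift u g) = f.sum fun s ξ => g.sum fun t η =>
      ⟪ξ, (F.toFun (star s * (u * t)) : H →L[ℂ] H) η⟫_ℂ := by
  unfold form shift
  refine Finset.sum_congr rfl fun s _ => ?_
  simp only
  rw [Finsupp.lmapDomain_apply, Finsupp.sum_mapDomain_index (fun s => by simp)
    (fun s ξ η => by simp)]

lemma form_shift (u : LocalTensor B) (f g : LocalTensor B →₀ H) :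
    F.form (shift u f) g = F.form f (shift (star u) g) := by
  rw [form_shift_left, form_shift_right]

lemma shift_shift (u v : LocalTensor B) (f : LocalTensor B →₀ H) :
    shift u (shift v f) = shift (u * v) f := by
  simp only [shift, Finsupp.lmapDomain_apply, ← Finsupp.mapDomain_comp]
  congr 1

lemma form_shift_single_add (i : ℕ) (b c : B) (f g : LocalTensor B →₀ H) :
    F.form f (shift (LocalTensor.single i (b + c)) g) =
      F.form f (shift (LocalTensor.single i b) g) + F.form f (shift (LocalTensor.single i c) g) := by
  simp only [form_shift_right, Finsupp.sum, ← Finset.sum_add_distrib, ← inner_add_right]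
  refine Finset.sum_congr rfl fun s _ => Finset.sum_congr rfl fun t _ => ?_
  rw [F.map_add i (star s * (LocalTensor.single i b * t)) (star s * (LocalTensor.single i c * t))]
  · rfl
  · intro k hk
    simp [LocalTensor.mul_apply, LocalTensor.single_ne _ _ hk]
  · simp [LocalTensor.mul_apply, LocalTensor.single_same, add_mul, mul_add]

lemma form_shift_single_smul (i : ℕ) (c : ℂ) (f g : LocalTensor B →₀ H) :
    F.form f (shift (LocalTensor.single i (c • (1 : B))) g) = c * F.form f g := by
  rw [form_shift_right]
  simp only [form, Finsupp.sum, Finset.mul_sum, ← inner_smul_right]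
  refine Finset.sum_congr rfl fun s _ => Finset.sum_congr rfl fun t _ => ?_
  rw [F.map_smul i c (star s * t)]
  · rfl
  · intro k hk
    simp [LocalTensor.mul_apply, LocalTensor.single_ne _ _ hk]
  · simp [LocalTensor.mul_apply, LocalTensor.single_same]

lemma shift_single_bound (i : ℕ) (b : B) (f : LocalTensor B →₀ H) :
    ‖F.toPre (shift (LocalTensor.single i b) f)‖ ≤ ‖(b : H →L[ℂ] H)‖ * ‖F.toPre f‖ := by
  obtain ⟨c, hc⟩ := exists_factor_bound b
  refine le_of_sq_le_sq ?_ (by positivity)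
  have h1 : ∀ d : B, F.form (shift (LocalTensor.single i d) f) (shift (LocalTensor.single i d) f) =
      F.form f (shift (LocalTensor.single i (star d * d)) f) := by
    intro d
    rw [form_shift, shift_shift, LocalTensor.star_single, LocalTensor.single_mul]
  have h2 := form_shift_single_add F i (star c * c) (star b * b) f f
  rw [hc, sub_add_cancel, form_shift_single_smul, ← hc, ← h1, ← h1] at h2
  have h3 := (Complex.le_def.1 (F.form_nonneg (shift (LocalTensor.single i c) f))).1
  have h4 := congrArg Complex.re h2
  rw [Complex.re_ofReal_mul, Complex.add_re] at h4
  rw [mul_pow, norm_sq, norm_sq]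
  simp only [Complex.zero_re] at h3
  linarith

lemma form_amp {T : H →L[ℂ] H} (hT : T ∈ B.commutant) (f g : LocalTensor B →₀ H) :
    F.form (amp T f) g = F.form f (amp (star T) g) := by
  unfold form amp
  rw [Finsupp.mapRange.linearMap_apply, Finsupp.sum_mapRange_index (fun s => by simp)]
  refine Finset.sum_congr rfl fun s _ => ?_
  simp only
  rw [Finsupp.mapRange.linearMap_apply, Finsupp.sum_mapRange_index (fun s => by simp)]
  refine Finset.sum_congr rfl fun t _ => ?_
  have h := commute_of_mem (F.toFun (star s * t)).2 (star_mem hT)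
  have h2 := DFunLike.congr_fun h.eq (g t)
  simp only [mul_apply_eq_comp] at h2
  simp only [ContinuousLinearMap.coe_coe]
  rw [h2, ContinuousLinearMap.star_eq_adjoint, ContinuousLinearMap.adjoint_inner_right]

lemma amp_amp (S T : H →L[ℂ] H) (f : LocalTensor B →₀ H) : amp S (amp T f) = amp (S * T) f := by
  ext s; simp [amp]

lemma form_amp_add (S T : H →L[ℂ] H) (f g : LocalTensor B →₀ H) :
    F.form f (amp (S + T) g) = F.form f (amp S g) + F.form f (amp T g) := by
  have : amp (S + T) g = amp S g + amp T g := by ext s; simp [amp]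
  rw [this, ← F.form_conj, form_add_left, _root_.map_add, form_conj, form_conj]

lemma form_amp_smul (c : ℂ) (f g : LocalTensor B →₀ H) :
    F.form f (amp (c • (1 : H →L[ℂ] H)) g) = c * F.form f g := by
  have : amp (c • (1 : H →L[ℂ] H)) g = c • g := by ext s; simp [amp]
  rw [this, ← F.form_conj, form_smul_left, _root_.map_mul, form_conj, Complex.conj_conj]

lemma amp_bound {T : H →L[ℂ] H} (hT : T ∈ B.commutant) (f : LocalTensor B →₀ H) :
    ‖F.toPre (amp T f)‖ ≤ ‖T‖ * ‖F.toPre f‖ := by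
  obtain ⟨⟨S, hS⟩, hc⟩ := exists_factor_bound (B := B.commutant) ⟨T, hT⟩
  have hc' : star S * S = ((‖T‖ ^ 2 : ℝ) : ℂ) • (1 : H →L[ℂ] H) - star T * T :=
    congrArg Subtype.val hc
  refine le_of_sq_le_sq ?_ (by positivity)
  have h1 : ∀ R ∈ B.commutant, F.form (amp R f) (amp R f) = F.form f (amp (star R * R) f) := by
    intro R hR
    rw [F.form_amp hR, amp_amp]
  have h2 := form_amp_add F (star S * S) (star T * T) f f
  rw [hc', sub_add_cancel, form_amp_smul, ← hc', ← h1 S hS, ← h1 T hT] at h2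
  have h3 := (Complex.le_def.1 (F.form_nonneg (amp S f))).1
  have h4 := congrArg Complex.re h2
  rw [Complex.re_ofReal_mul, Complex.add_re] at h4
  rw [mul_pow, norm_sq, norm_sq]
  simp only [Complex.zero_re] at h3
  linarith

end LocalCPMap

namespace LocalCPMap

variable (F : LocalCPMap B)

/-- The dilation space of `F`: the Hilbert space completion of `PreSpace`. -/
abbrev Space : Type u := UniformSpace.Completion F.PreSpace

/-- The operator on the dilation space induced by a bounded linear map on `PreSpace`. -/
def lift (L : (LocalTensor B →₀ H) →ₗ[ℂ] (LocalTensor B →₀ H)) (K : ℝ)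
    (hL : ∀ f, ‖F.toPre (L f)‖ ≤ K * ‖F.toPre f‖) : F.Space →L[ℂ] F.Space :=
  (LinearMap.mkContinuous (F.toPre.toLinearMap ∘ₗ L ∘ₗ F.toPre.symm.toLinearMap) K
    fun f => hL (F.toPre.symm f)).completion

section
variable {F}
variable {L M N : (LocalTensor B →₀ H) →ₗ[ℂ] (LocalTensor B →₀ H)} {K K' K'' : ℝ}
  (hL : ∀ f, ‖F.toPre (L f)‖ ≤ K * ‖F.toPre f‖) (hM : ∀ f, ‖F.toPre (M f)‖ ≤ K' * ‖F.toPre f‖)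
  (hN : ∀ f, ‖F.toPre (N f)‖ ≤ K'' * ‖F.toPre f‖)

lemma lift_coe (f : LocalTensor B →₀ H) :
    F.lift L K hL (F.toPre f : F.Space) = (F.toPre (L f) : F.Space) :=
  ContinuousLinearMap.completion_apply_coe _ _

lemma dense_ind {p : F.Space → Prop} (hp : IsClosed {x | p x})
    (h : ∀ f : LocalTensor B →₀ H, p (F.toPre f : F.Space)) (x : F.Space) : p x :=
  UniformSpace.Completion.induction_on x hp fun f => h (F.toPre.symm f)

lemma op_ext {S T : F.Space →L[ℂ] F.Space}
    (h : ∀ f g : LocalTensor B →₀ H, ⟪(F.toPre f : F.Space), S (F.toPre g : F.Space)⟫_ℂ =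
      ⟪(F.toPre f : F.Space), T (F.toPre g : F.Space)⟫_ℂ) : S = T := by
  apply ContinuousLinearMap.ext
  intro x
  apply ext_inner_left ℂ
  intro y
  refine dense_ind (p := fun x => ⟪y, S x⟫_ℂ = ⟪y, T x⟫_ℂ)
    (isClosed_eq (by fun_prop) (by fun_prop)) (fun g => ?_) x
  exact dense_ind (p := fun y => ⟪y, S (F.toPre g : F.Space)⟫_ℂ = ⟪y, T (F.toPre g : F.Space)⟫_ℂ)
    (isClosed_eq (by fun_prop) (by fun_prop)) (fun f => h f g) y

lemma inner_lift (f g : LocalTensor B →₀ H) :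
    ⟪(F.toPre f : F.Space), F.lift L K hL (F.toPre g : F.Space)⟫_ℂ = F.form f (L g) := by
  rw [lift_coe, UniformSpace.Completion.inner_coe, inner_toPre]

lemma norm_lift_le (hK : 0 ≤ K) : ‖F.lift L K hL‖ ≤ K := by
  refine ContinuousLinearMap.opNorm_le_bound _ hK fun x => ?_
  refine dense_ind (p := fun x => ‖F.lift L K hL x‖ ≤ K * ‖x‖)
    (isClosed_le (by fun_prop) (by fun_prop)) (fun f => ?_) x
  rw [lift_coe, UniformSpace.Completion.norm_coe, UniformSpace.Completion.norm_coe]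
  exact hL f

lemma lift_mul (h : ∀ f, L (M f) = N f) : F.lift L K hL * F.lift M K' hM = F.lift N K'' hN := by
  apply op_ext
  intro f g
  rw [mul_apply_eq_comp, lift_coe, inner_lift, inner_lift, h]

lemma star_lift (h : ∀ f g, F.form (L f) g = F.form f (M g)) :
    star (F.lift L K hL) = F.lift M K' hM := by
  apply op_ext
  intro f g
  rw [ContinuousLinearMap.star_eq_adjoint, ContinuousLinearMap.adjoint_inner_right, lift_coe,
    UniformSpace.Completion.inner_coe, inner_toPre, inner_lift, h]

end

/-- The action of `J_i(b)` on the dilation space, `s ⊗ ξ ↦ (J_i(b) s) ⊗ ξ`. -/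
def rep (i : ℕ) (b : B) : F.Space →L[ℂ] F.Space :=
  F.lift (shift (LocalTensor.single i b)) ‖(b : H →L[ℂ] H)‖ (F.shift_single_bound i b)

/-- The action on the dilation space of an operator in the commutant of `B`. -/
def repComm {T : H →L[ℂ] H} (hT : T ∈ B.commutant) : F.Space →L[ℂ] F.Space :=
  F.lift (amp T) ‖T‖ (F.amp_bound hT)

lemma rep_comm (i : ℕ) (b : B) {T : H →L[ℂ] H} (hT : T ∈ B.commutant) :
    F.rep i b * F.repComm hT = F.repComm hT * F.rep i b := by
  apply op_ext
  intro f g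
  rw [mul_apply_eq_comp, mul_apply_eq_comp]
  simp only [rep, repComm, lift_coe]
  congr 3
  exact Finsupp.mapDomain_mapRange _ g (fun x => T x) (_root_.map_zero T) (_root_.map_add T)

/-- The vector `1 ⊗ ξ`, as a bounded operator from `H` to the dilation space. -/
def embed : H →L[ℂ] F.Space :=
  UniformSpace.Completion.toComplL ∘L
    LinearMap.mkContinuous (F.toPre.toLinearMap ∘ₗ Finsupp.lsingle 1)
      (‖(F.toFun 1 : H →L[ℂ] H)‖ + 1) (by
        intro ξ
        refine le_of_sq_le_sq ?_ (by positivity)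
        change ‖F.toPre (Finsupp.single 1 ξ)‖ ^ 2 ≤ _
        rw [norm_sq]
        have h1 : F.form (Finsupp.single 1 ξ) (Finsupp.single 1 ξ) =
            ⟪ξ, (F.toFun 1 : H →L[ℂ] H) ξ⟫_ℂ := by
          simp [form, Finsupp.sum_single_index]
        rw [h1]
        have h2 : (⟪ξ, (F.toFun 1 : H →L[ℂ] H) ξ⟫_ℂ).re ≤
            ‖(F.toFun 1 : H →L[ℂ] H)‖ * ‖ξ‖ ^ 2 := by
          refine (Complex.re_le_norm _).trans ((norm_inner_le_norm _ _).trans ?_)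
          have := (F.toFun 1 : H →L[ℂ] H).le_opNorm ξ
          nlinarith [norm_nonneg ξ]
        nlinarith [norm_nonneg (F.toFun 1 : H →L[ℂ] H), sq_nonneg ‖ξ‖,
          mul_nonneg (norm_nonneg (F.toFun 1 : H →L[ℂ] H)) (sq_nonneg ‖ξ‖),
          mul_nonneg (sq_nonneg ‖(F.toFun 1 : H →L[ℂ] H)‖) (sq_nonneg ‖ξ‖)])

lemma embed_apply (ξ : H) : F.embed ξ = (F.toPre (Finsupp.single 1 ξ) : F.Space) := rfl

lemma repComm_embed {T : H →L[ℂ] H} (hT : T ∈ B.commutant) (ξ : H) :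
    F.repComm hT (F.embed ξ) = F.embed (T ξ) := by
  rw [embed_apply, embed_apply, repComm, lift_coe]
  simp [amp]

end LocalCPMap

/-! ### The infinite tensor product -/

variable (B) in
/-- The Hilbert space on which the infinite tensor product acts: the direct sum of the dilation
spaces of all completely positive maps from the algebraic infinite tensor product to `B`. -/
abbrev UnivSpace : Type u := lp (fun F : LocalCPMap B => F.Space) 2

/-- The operator `J_i(b) = 1 ⊗ ⋯ ⊗ 1 ⊗ b ⊗ 1 ⊗ ⋯` on `UnivSpace`. -/
def siteOp (i : ℕ) (b : B) : UnivSpace B →L[ℂ] UnivSpace B :=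
  lp.mapCLM 2 (fun F : LocalCPMap B => F.rep i b) (norm_nonneg (b : H →L[ℂ] H))
    fun _ => LocalCPMap.norm_lift_le _ (norm_nonneg _)

lemma siteOp_apply (i : ℕ) (b : B) (x : UnivSpace B) (F : LocalCPMap B) :
    siteOp i b x F = F.rep i b (x F) := rfl

/-- The commutant of a set of operators, as a von Neumann algebra. -/
def commutantOf {K : Type u} [NormedAddCommGroup K] [InnerProductSpace ℂ K] [CompleteSpace K]
    (X : Set (K →L[ℂ] K)) : VonNeumannAlgebra K where
  toStarSubalgebra := StarSubalgebra.centralizer ℂ X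
  centralizer_centralizer' := by simp [StarSubalgebra.coe_centralizer]

lemma mem_commutantOf {K : Type u} [NormedAddCommGroup K] [InnerProductSpace ℂ K] [CompleteSpace K]
    {X : Set (K →L[ℂ] K)} {z : K →L[ℂ] K} :
    z ∈ commutantOf X ↔ ∀ g ∈ X, g * z = z * g ∧ star g * z = z * star g :=
  StarSubalgebra.mem_centralizer_iff ℂ

variable (B) in
/-- The infinite tensor product `𝒜` of countably many copies of `B`: the von Neumann algebra
generated by the operators `J_i(b)` on `UnivSpace B`. -/
def InfTensor : VonNeumannAlgebra (UnivSpace B) :=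
  (commutantOf {x | ∃ (i : ℕ) (b : B), x = siteOp i b}).commutant

lemma siteOp_mem (i : ℕ) (b : B) : siteOp i b ∈ InfTensor B :=
  VonNeumannAlgebra.mem_commutant_iff.2 fun _ hg =>
    ((mem_commutantOf.1 hg _ ⟨i, b, rfl⟩).1).symm

lemma univ_ext {S T : UnivSpace B →L[ℂ] UnivSpace B}
    (h : ∀ (x : UnivSpace B) (F : LocalCPMap B), S x F = T x F) : S = T :=
  ContinuousLinearMap.ext fun x => lp.ext (funext fun F => h x F)

lemma siteOp_mul (i : ℕ) (b c : B) : siteOp i b * siteOp i c = siteOp i (b * c) := by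
  apply univ_ext
  intro x F
  rw [mul_apply_eq_comp, siteOp_apply, siteOp_apply, siteOp_apply, ← mul_apply_eq_comp]
  refine DFunLike.congr_fun (LocalCPMap.lift_mul _ _ _ fun f => ?_) (x F)
  rw [LocalCPMap.shift_shift, LocalTensor.single_mul]

lemma star_siteOp (i : ℕ) (b : B) : star (siteOp i b) = siteOp i (star b) := by
  apply ContinuousLinearMap.ext
  intro x
  apply ext_inner_left ℂ
  intro y
  rw [ContinuousLinearMap.star_eq_adjoint, ContinuousLinearMap.adjoint_inner_right,
    lp.inner_eq_tsum, lp.inner_eq_tsum]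
  refine tsum_congr fun F => ?_
  have h : star (F.rep i b) = F.rep i (star b) := by
    refine LocalCPMap.star_lift _ _ fun f g => ?_
    rw [LocalCPMap.form_shift, LocalTensor.star_single]
  rw [siteOp_apply, siteOp_apply, ← h, ContinuousLinearMap.star_eq_adjoint,
    ContinuousLinearMap.adjoint_inner_right]

lemma siteOp_add (i : ℕ) (b c : B) : siteOp i (b + c) = siteOp i b + siteOp i c := by
  apply univ_ext
  intro x F
  change F.rep i (b + c) (x F) = (F.rep i b + F.rep i c) (x F)
  refine DFunLike.congr_fun (LocalCPMap.op_ext fun f g => ?_) (x F)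
  rw [add_apply, inner_add_right]
  simp only [LocalCPMap.rep, LocalCPMap.inner_lift, LocalCPMap.form_shift_single_add]

lemma siteOp_algebraMap (i : ℕ) (c : ℂ) :
    siteOp i (algebraMap ℂ B c) = algebraMap ℂ (UnivSpace B →L[ℂ] UnivSpace B) c := by
  apply univ_ext
  intro x F
  rw [Algebra.algebraMap_eq_smul_one, Algebra.algebraMap_eq_smul_one]
  change F.rep i (c • (1 : B)) (x F) = (c • (1 : F.Space →L[ℂ] F.Space)) (x F)
  refine DFunLike.congr_fun (LocalCPMap.op_ext fun f g => ?_) (x F)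
  rw [smul_apply, inner_smul_right, one_apply_eq_self, UniformSpace.Completion.inner_coe,
    LocalCPMap.inner_toPre]
  simp only [LocalCPMap.rep, LocalCPMap.inner_lift, LocalCPMap.form_shift_single_smul]

/-- The embedding `J_i : B → 𝒜`, `J_i(b) = 1 ⊗ ⋯ ⊗ 1 ⊗ b ⊗ 1 ⊗ ⋯` with `b` at the `i`-th place. -/
def J (i : ℕ) : B →⋆ₐ[ℂ] InfTensor B where
  toFun b := ⟨siteOp i b, siteOp_mem i b⟩
  map_one' := Subtype.ext (by simpa using siteOp_algebraMap (B := B) i 1)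
  map_mul' b c := Subtype.ext (siteOp_mul i b c).symm
  map_zero' := Subtype.ext (by simpa using siteOp_algebraMap (B := B) i 0)
  map_add' b c := Subtype.ext (siteOp_add i b c)
  commutes' c := Subtype.ext (siteOp_algebraMap i c)
  map_star' b := Subtype.ext (star_siteOp i b).symm

/-- Different tensor factors commute. -/
lemma J_comm {i k : ℕ} (h : i ≠ k) (b c : B) : J i b * J k c = J k c * J i b := by
  apply Subtype.ext
  apply univ_ext
  intro x F
  change (F.rep i b * F.rep k c) (x F) = (F.rep k c * F.rep i b) (x F)
  refine DFunLike.congr_fun (LocalCPMap.op_ext fun f g => ?_) (x F)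
  rw [mul_apply_eq_comp, mul_apply_eq_comp]
  simp only [LocalCPMap.rep, LocalCPMap.lift_coe, LocalCPMap.shift_shift]
  have : LocalTensor.single i b * LocalTensor.single k c =
      LocalTensor.single k c * LocalTensor.single i b := by
    apply Subtype.ext
    funext l
    rw [LocalTensor.mul_apply, LocalTensor.mul_apply]
    by_cases h1 : l = i
    · rw [LocalTensor.single_ne k l (by omega), mul_one, one_mul]
    · rw [LocalTensor.single_ne i l h1, mul_one, one_mul]
  rw [this]

/-- The vectors fixed by `J_k(p)` for all `k ≥ n`. -/
def tailSpace (n : ℕ) (p : B) : Submodule ℂ (UnivSpace B) :=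
  ⨅ k : {k : ℕ // n ≤ k}, (1 - (J k.1 p : UnivSpace B →L[ℂ] UnivSpace B)).ker

lemma mem_tailSpace (n : ℕ) (p : B) (x : UnivSpace B) :
    x ∈ tailSpace n p ↔ ∀ k, n ≤ k → (J k p : UnivSpace B →L[ℂ] UnivSpace B) x = x := by
  simp only [tailSpace, Submodule.mem_iInf, Subtype.forall]
  refine forall₂_congr fun k hk => ?_
  rw [LinearMap.mem_ker]
  change x - _ = 0 ↔ _
  rw [sub_eq_zero, eq_comm]
  rfl

lemma isClosed_tailSpace (n : ℕ) (p : B) : IsClosed (tailSpace n p : Set (UnivSpace B)) := by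
  rw [tailSpace, Submodule.coe_iInf]
  exact isClosed_iInter fun k => ContinuousLinearMap.isClosed_ker _

instance (n : ℕ) (p : B) : (tailSpace n p).HasOrthogonalProjection :=
  haveI : CompleteSpace (tailSpace n p) := (isClosed_tailSpace n p).completeSpace_coe
  inferInstance

/-- For a projection `p` of `B`, the projection
`p_{[n} = 1 ⊗ ⋯ ⊗ 1 ⊗ p ⊗ p ⊗ ⋯`, with `p` at all places `k ≥ n`: the infimum (and strong limit)
of the projections `J_n(p) J_{n+1}(p) ⋯ J_N(p)`, that is, the orthogonal projection onto the
vectors fixed by all of `J_k(p)`, `k ≥ n`. -/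
def tailProj (n : ℕ) (p : B) : InfTensor B :=
  ⟨(tailSpace n p).starProjection, by
    refine (VonNeumannAlgebra.IsStarProjection.mem_iff isStarProjection_starProjection _).2
      fun y hy => ?_
    rw [Submodule.range_starProjection, Module.End.mem_invtSubmodule]
    intro x hx
    rw [Submodule.mem_comap, mem_tailSpace]
    intro k hk
    have h1 := DFunLike.congr_fun (commute_of_mem (J k p).2 hy).eq x
    simp only [mul_apply_eq_comp, (mem_tailSpace n p x).1 hx k hk] at h1
    exact h1⟩

/-- The action on `UnivSpace` of an operator in the commutant of `B`. -/
def univComm {T : H →L[ℂ] H} (hT : T ∈ B.commutant) :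
    UnivSpace B →L[ℂ] UnivSpace B :=
  lp.mapCLM 2 (fun F : LocalCPMap B => F.repComm hT) (norm_nonneg T)
    fun _ => LocalCPMap.norm_lift_le _ (norm_nonneg _)

/-! ### The conditional expectation `E_{0]}` and quantum Markov chains -/

namespace LocalCPMap

variable (F : LocalCPMap B)

open Classical in
/-- The vector `1 ⊗ ξ` in the summand belonging to `F`. -/
def vec : H →L[ℂ] UnivSpace B :=
  lp.singleContinuousLinearMap ℂ (fun F : LocalCPMap B => F.Space) 2 F ∘L F.embed

lemma univComm_commute {T : H →L[ℂ] H} (hT : T ∈ B.commutant)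
    {x : UnivSpace B →L[ℂ] UnivSpace B} (hx : x ∈ InfTensor B) (y : UnivSpace B) :
    x (univComm hT y) = univComm hT (x y) := by
  have hcomm : ∀ i (b : B), siteOp i b * univComm hT = univComm hT * siteOp i b := fun i b =>
    univ_ext fun y G => DFunLike.congr_fun (G.rep_comm i b hT) (y G)
  have h : univComm hT * x = x * univComm hT := by
    refine VonNeumannAlgebra.mem_commutant_iff.1 hx _ (mem_commutantOf.2 ?_)
    rintro g ⟨i, b, rfl⟩
    exact ⟨hcomm i b, by rw [star_siteOp]; exact hcomm i (star b)⟩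
  exact (DFunLike.congr_fun h y).symm

lemma univComm_vec {T : H →L[ℂ] H} (hT : T ∈ B.commutant) (ξ : H) :
    univComm hT (F.vec ξ) = F.vec (T ξ) := by
  classical
  apply lp.ext
  funext G
  change G.repComm hT (Pi.single F (F.embed ξ) G) = Pi.single F (F.embed (T ξ)) G
  by_cases hG : G = F
  · subst hG
    rw [Pi.single_eq_same, Pi.single_eq_same, repComm_embed]
  · rw [Pi.single_eq_of_ne hG, Pi.single_eq_of_ne hG, _root_.map_zero]

lemma inner_univComm {T : H →L[ℂ] H} (hT : T ∈ B.commutant) (x y : UnivSpace B) :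
    ⟪x, univComm hT y⟫_ℂ = ⟪univComm (star_mem hT) x, y⟫_ℂ := by
  rw [lp.inner_eq_tsum, lp.inner_eq_tsum]
  refine tsum_congr fun G => ?_
  have h : star (G.repComm (star_mem hT)) = G.repComm hT := by
    refine LocalCPMap.star_lift _ _ fun f g => ?_
    rw [G.form_amp (star_mem hT), star_star]
  change ⟪x G, G.repComm hT (y G)⟫_ℂ = ⟪G.repComm (star_mem hT) (x G), y G⟫_ℂ
  rw [← h, ContinuousLinearMap.star_eq_adjoint, ContinuousLinearMap.adjoint_inner_right]

lemma vec_mem {x : UnivSpace B →L[ℂ] UnivSpace B} (hx : x ∈ InfTensor B) :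
    ContinuousLinearMap.adjoint F.vec ∘L x ∘L F.vec ∈ B := by
  apply mem_of_commute
  intro T hT
  apply ContinuousLinearMap.ext
  intro ξ
  apply ext_inner_left ℂ
  intro η
  simp only [mul_apply_eq_comp, ContinuousLinearMap.comp_apply]
  rw [ContinuousLinearMap.adjoint_inner_right, ← univComm_vec F hT, univComm_commute hT hx,
    inner_univComm, univComm_vec, ContinuousLinearMap.star_eq_adjoint,
    ← ContinuousLinearMap.adjoint_inner_right, ContinuousLinearMap.adjoint_inner_left]

/-- The unique normal extension to `𝒜` of a completely positive map `F` on the algebraic infinite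
tensor product: `a ↦ V* a V` with `V ξ = 1 ⊗ ξ` in the summand of `F`. -/
def extend : InfTensor B →ₗ[ℂ] B where
  toFun a := ⟨ContinuousLinearMap.adjoint F.vec ∘L (a : UnivSpace B →L[ℂ] UnivSpace B) ∘L F.vec,
    F.vec_mem a.2⟩
  map_add' a b := Subtype.ext (by
    apply ContinuousLinearMap.ext
    intro ξ
    exact _root_.map_add (ContinuousLinearMap.adjoint F.vec) _ _)
  map_smul' c a := Subtype.ext (by
    apply ContinuousLinearMap.ext
    intro ξ
    exact _root_.map_smul (ContinuousLinearMap.adjoint F.vec) c _)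

lemma inner_extend (a : InfTensor B) (ξ η : H) :
    ⟪ξ, (F.extend a : H →L[ℂ] H) η⟫_ℂ =
      ⟪F.vec ξ, (a : UnivSpace B →L[ℂ] UnivSpace B) (F.vec η)⟫_ℂ := by
  have h : (F.extend a : H →L[ℂ] H) η = ContinuousLinearMap.adjoint F.vec
      ((a : UnivSpace B →L[ℂ] UnivSpace B) (F.vec η)) := rfl
  rw [h, ContinuousLinearMap.adjoint_inner_right]

end LocalCPMap

/-- The elementary tensor `a₀ ⊗ a₁ ⊗ ⋯ ⊗ a_{n-1} ⊗ 1 ⊗ ⋯ = J₀(a₀) J₁(a₁) ⋯ J_{n-1}(a_{n-1})`. -/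
def elemTensor (a : ℕ → B) : ℕ → InfTensor B
  | 0 => 1
  | n + 1 => elemTensor a n * J n (a n)

/-- `extend F` does extend `F`. -/
lemma LocalCPMap.extend_elemTensor (F : LocalCPMap B) (n : ℕ) (s : LocalTensor B)
    (hs : ∀ k, n ≤ k → s.1 k = 1) : F.extend (elemTensor s.1 n) = F.toFun s := by
  classical
  have key : ∀ (n : ℕ) (s t u : LocalTensor B) (ξ : H), (∀ k, k < n → u.1 k = s.1 k * t.1 k) →
      (∀ k, n ≤ k → u.1 k = t.1 k) →
      (elemTensor s.1 n : UnivSpace B →L[ℂ] UnivSpace B)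
        (lp.single 2 F (F.toPre (Finsupp.single t ξ) : F.Space)) =
      lp.single 2 F (F.toPre (Finsupp.single u ξ) : F.Space) := by
    intro n
    induction n with
    | zero =>
      intro s t u ξ _ h
      have : u = t := Subtype.ext (funext fun k => h k (Nat.zero_le k))
      rw [this]
      rfl
    | succ n ih =>
      intro s t u ξ h1 h2
      have hJ : (J n (s.1 n) : UnivSpace B →L[ℂ] UnivSpace B)
          (lp.single 2 F (F.toPre (Finsupp.single t ξ) : F.Space)) =
          lp.single 2 F (F.toPre (Finsupp.single (LocalTensor.single n (s.1 n) * t) ξ) :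
            F.Space) := by
        apply lp.ext
        funext G
        change G.rep n (s.1 n) (Pi.single F _ G) = Pi.single F _ G
        by_cases hG : G = F
        · subst hG
          rw [Pi.single_eq_same, Pi.single_eq_same, rep, lift_coe]
          simp [shift]
        · rw [Pi.single_eq_of_ne hG, Pi.single_eq_of_ne hG, _root_.map_zero]
      change (elemTensor s.1 n : UnivSpace B →L[ℂ] UnivSpace B)
        ((J n (s.1 n) : UnivSpace B →L[ℂ] UnivSpace B) _) = _
      rw [hJ]
      refine ih s _ u ξ (fun k hk => ?_) fun k hk => ?_
      · rw [LocalTensor.mul_apply, LocalTensor.single_ne _ _ (by omega), one_mul,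
          h1 k (by omega)]
      · rw [LocalTensor.mul_apply]
        by_cases hkn : k = n
        · subst hkn
          rw [LocalTensor.single_same, h1 k (by omega)]
        · rw [LocalTensor.single_ne _ _ hkn, one_mul, h2 k (by omega)]
  apply Subtype.ext
  apply ContinuousLinearMap.ext
  intro η
  apply ext_inner_left ℂ
  intro ξ
  have hv : ∀ ζ, F.vec ζ = lp.single 2 F (F.toPre (Finsupp.single 1 ζ) : F.Space) := by
    intro ζ
    apply lp.ext
    funext G
    change Pi.single F _ G = Pi.single F _ G
    congr!
  rw [F.inner_extend, hv, hv, key n s 1 s η (fun k _ => by simp) (fun k hk => by simp [hs k hk]),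
    lp.inner_single_left, lp.single_apply_self, UniformSpace.Completion.inner_coe, inner_toPre]
  simp [form, Finsupp.sum_single_index]

/-- The map `E_{0]} : 𝒜 → 𝒜_{0]} = B` of a sequence of transition expectations. -/
def E0 : InfTensor B →ₗ[ℂ] B := (localE0 ℰ).extend

/-- The defining formula of `E_{0]}` on `a = a₀ ⊗ ⋯ ⊗ a_{n-1} ⊗ 1 ⊗ ⋯`. -/
lemma E0_spec (n : ℕ) (s : LocalTensor B) (hs : ∀ k, n ≤ k → s.1 k = 1) (ξ : H) :
    Tendsto (fun m => (nested ℰ s.1 0 (m + 1) (bbar ℰ (m + 1)) : H →L[ℂ] H) ξ) atTop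
      (𝓝 ((E0 ℰ (elemTensor s.1 n) : H →L[ℂ] H) ξ)) := by
  rw [E0, LocalCPMap.extend_elemTensor _ n s hs]
  exact localE0_spec ℰ s ξ

variable (B) in
/-- A (nonhomogeneous) quantum Markov chain, given as a Markov pair: a state `φ₀` of `B` and a
sequence of transition expectations such that `φ₀ ∘ E_{0]}` is a state, that is,
`φ₀ (E_{0]} 1) = 1`. -/
structure QMC where
  /-- the initial state -/
  φ₀ : B →ₗ[ℂ] ℂ
  nonneg : ∀ b, 0 ≤ φ₀ (star b * b)
  map_one : φ₀ 1 = 1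
  /-- the transition expectations -/
  ℰ : ℕ → TransitionExpectation B
  markovian : φ₀ (E0 ℰ 1) = 1

/-- `p` is a nontrivial projection of `B`. -/
def IsNontrivialProj (p : B) : Prop := IsStarProjection p ∧ p ≠ 0 ∧ p ≠ 1

/-- The chain is reducible: `E_{0]} (p_{[n₀} a p_{[n₀}) = E_{0]} a` for all `a` in `𝒜`, for some
nontrivial projection `p` of `B` and some `n₀`. -/
def QMC.IsReducible (C : QMC B) : Prop :=
  ∃ (p : B) (n₀ : ℕ), IsNontrivialProj p ∧
    ∀ a : InfTensor B, E0 C.ℰ (tailProj n₀ p * a * tailProj n₀ p) = E0 C.ℰ a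

end

end QuantumMarkov

/-! The map `E0` is a compression. By construction `E0 ℰ a = V* a V`, where `V` sends `ξ` to the
vector `1 ⊗ ξ` in the summand of `UnivSpace B` that dilates `localE0 ℰ`; `inner_extend` is this
identity in matrix coefficients. The element `p_{[n}` is likewise concrete: it is the orthogonal
projection `P` of the same Hilbert space onto `tailSpace n p`. Both sides of the equivalence
therefore become statements about the position of the range of `V` relative to the range of `P`.

Since `1 - P` is a projection, `V* (1 - P) V = ((1 - P) V)* ((1 - P) V)`, and this vanishes exactly
when `P V = V`. The direction needed below is `tailProj_vec`. Once `P V = V`, also `V* P = V*`, so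
`V* P a P V = V* a V` for every `a`. In the other direction the reducibility identity at `a = 1`,
together with `P P = P` (`tailProj_mul_self`), says `V* P V = V* V`, that is, `E0 (1 - P) = 0`.

This is the familiar Cauchy-Schwarz argument for a completely positive map `E`: if `E` kills a
projection `q`, it kills `q a` and `a q` for every `a`. In the dilation the inequality becomes the
exact statement that `q` annihilates the vectors `V ξ`. Hence `a` may be any element of the von
Neumann algebra from the start: there is no approximation by elementary tensors, and neither the
limits defining `localE0` nor the finite products `J_n(p) ⋯ J_N(p)` reappear. The operator `V` need
not be an isometry, because `V* V = E0 1` may be smaller than `1`; the argument uses only `P V = V`.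
-/

open QuantumMarkov in
/-- The tail projection is idempotent. -/
theorem QuantumMarkov.tailProj_mul_self {H : Type*} [NormedAddCommGroup H] [InnerProductSpace ℂ H]
    [CompleteSpace H] {B : VonNeumannAlgebra H} (n : ℕ) (p : B) :
    tailProj n p * tailProj n p = tailProj n p :=
  -- No condition on `p` is needed: the operator is an orthogonal projection because of how it is
  -- defined, whatever the fixed subspace of the `J k p` may be.
  Subtype.ext (isStarProjection_starProjection (U := tailSpace n p)).isIdempotentElem.eq

open QuantumMarkov in
/-- If the extension of `F` vanishes on the complement of the tail projection, then the tail
projection fixes the vectors `1 ⊗ ξ` in the summand of `F`. -/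
theorem QuantumMarkov.LocalCPMap.tailProj_vec {H : Type*} [NormedAddCommGroup H]
    [InnerProductSpace ℂ H] [CompleteSpace H] {B : VonNeumannAlgebra H} (F : LocalCPMap B)
    {n : ℕ} {p : B} (h : F.extend (1 - tailProj n p) = 0) (ξ : H) :
    (tailSpace n p).starProjection (F.vec ξ) = F.vec ξ := by
  -- Diagonal coefficients suffice, since the goal is that `(1 - P) V ξ` has norm zero. After the
  -- rewriting below, `h1` reads `0 = ⟪V ξ, V ξ - P V ξ⟫`.
  have h1 := F.inner_extend (1 - tailProj n p) ξ ξ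
  have h2 : ((1 - tailProj n p : InfTensor B) : UnivSpace B →L[ℂ] UnivSpace B) (F.vec ξ) =
      F.vec ξ - (tailSpace n p).starProjection (F.vec ξ) := rfl
  have h3 : ((0 : B) : H →L[ℂ] H) ξ = 0 := rfl
  rw [h, h3, inner_zero_right, h2] at h1
  -- The component of `V ξ` in the tail space is orthogonal to the remainder; this is where `P` has
  -- to be an orthogonal projection and not merely an idempotent.
  have h4 : ⟪(tailSpace n p).starProjection (F.vec ξ),
      F.vec ξ - (tailSpace n p).starProjection (F.vec ξ)⟫_ℂ = 0 :=
    Submodule.inner_right_of_mem_orthogonal (Submodule.starProjection_apply_mem _ _)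
      (Submodule.sub_starProjection_mem_orthogonal _)
  -- With `w = V ξ - P V ξ`, the square of the norm is `⟪w, w⟫ = ⟪V ξ, w⟫ - ⟪P V ξ, w⟫`. The first
  -- term vanishes by the hypothesis on `F.extend` and the second by orthogonality.
  have h5 : F.vec ξ - (tailSpace n p).starProjection (F.vec ξ) = 0 := by
    rw [← inner_self_eq_zero (𝕜 := ℂ), inner_sub_left, ← h1, h4, sub_zero]
  exact (sub_eq_zero.1 h5).symm

/-- The two conditions are equivalent for each pair `(p, n₀)` separately, so the same projection and
the same starting place serve in both directions. One direction is the evaluation at the identity;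
the other is the invariance of the dilation vectors under the tail projection. -/
theorem mainTheorem6 {H : Type*} [NormedAddCommGroup H] [InnerProductSpace ℂ H] [CompleteSpace H]
    {B : VonNeumannAlgebra H} (C : QuantumMarkov.QMC B) :
    C.IsReducible ↔
      ∃ (p : B) (n₀ : ℕ), QuantumMarkov.IsNontrivialProj p ∧
        QuantumMarkov.E0 C.ℰ (1 - QuantumMarkov.tailProj n₀ p) = 0 := by
  refine exists_congr fun p => exists_congr fun n => and_congr_right fun _ => ⟨fun h => ?_,
    fun h a => ?_⟩
  -- At `a = 1` the compressed element is `P * 1 * P = P`, so the hypothesis becomes `E0 P = E0 1`,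
  -- and linearity finishes.
  · have h1 := h 1
    rw [mul_one, QuantumMarkov.tailProj_mul_self] at h1
    rw [map_sub, h1, sub_self]
  -- `E0` unfolds to the extension of `localE0`, so `h` is the vanishing that `tailProj_vec`
  -- requires, and `hv` is `P V = V` on every vector of `H`.
  · have hv := (QuantumMarkov.localE0 C.ℰ).tailProj_vec h
    apply Subtype.ext
    apply ContinuousLinearMap.ext
    intro η
    apply ext_inner_left ℂ
    intro ξ
    -- Both sides become matrix coefficients on `UnivSpace B`, and the goal is `⟪V ξ, P a P V η⟫ =
    -- ⟪V ξ, a V η⟫`.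
    rw [QuantumMarkov.E0, QuantumMarkov.LocalCPMap.inner_extend,
      QuantumMarkov.LocalCPMap.inner_extend]
    change ⟪_, (QuantumMarkov.tailSpace n p).starProjection ((a : _ →L[ℂ] _)
      ((QuantumMarkov.tailSpace n p).starProjection _))⟫_ℂ = _
    -- Self-adjointness moves the outer projection onto `V ξ`. Both copies of `P` then act directly
    -- on vectors in the range of `V`, and `hv` removes them one at a time.
    rw [← Submodule.inner_starProjection_left_eq_right, hv, hv]
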